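/- Let $N\ge 1$, let $\Omega\subset\mathbb{R}^N$ be a bounded open set, let $2\le p<\infty$ and $\frac1p+\frac1q=1$. Let $W_0^{1,p}(\Omega)$ be the closure of $C_0^\infty(\Omega)$ in $W^{1,p}(\Omega)$ with respect to the norm $\|y\|=\big(\int_\Omega\sum_{i=1}^N|\partial_i y|^p\,dx+\int_\Omega|y|^p\,dx\big)^{1/p}$, and write $\langle v,z\rangle=\int_\Omega v z\,dx$ for $v\in L^q(\Omega)$, $z\in L^p(\Omega)$. Let $B:L^q(\Omega)\to L^p(\Omega)$ be a continuous linear operator that is positive, i.e. $\langle v,Bv\rangle>0$ for all $v\ne0$. Let $B_r^{-1}:D\to L^q(\Omega)$, $D\subseteq L^p(\Omega)$, be a right inverse of $B$ on $D$, i.e. $B B_r^{-1}z=z$ for all $z\in D$ ($D=L^p(\Omega)$ is allowed), and let $g\in D$. Let $F:W_0^{1,p}(\Omega)\times L^p(\Omega)\to L^q(\Omega)$ satisfy the following conditions. 1. (Uniformly semi-bounded variation.) For every bounded set $Y_0\subset W_0^{1,p}(\Omega)$ there are functions $C_y:\mathbb{R}_+\times\mathbb{R}_+\to\mathbb{R}$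 and a seminorm $|\!|\!|\cdot|\!|\!|$ on $L^p(\Omega)$ that is compact with respect to the norm (every norm-bounded sequence has a subsequence that is Cauchy for $|\!|\!|\cdot|\!|\!|$), such that for each $y\in Y_0$ the function $C_y$ is continuous and $\frac1t C_y(r,t)\to0$ as $t\to0^+$ for all $r>0$, and such that $$\langle F(y,z_1)-F(y,z_2),z_1-z_2\rangle\ \ge\ -\inf_{y'\in Y_0}C_{y'}\big(R;|\!|\!|z_1-z_2|\!|\!|\big)$$ whenever $y\in Y_0$ and $\|z_1\|_{L^p(\Omega)},\|z_2\|_{L^p(\Omega)}\le R$. 2. (Radial continuity.) For every $y\in W_0^{1,p}(\Omega)$ and $z_1,z_2\in L^p(\Omega)$ there is $\varepsilon>0$ such that $\tau\mapsto\langle F(y,z_1+\tau z_2),z_2\rangle$ is continuous on $[0,\varepsilon]$. 3. For every bounded set $Y_0\subset W_0^{1,p}(\Omega)$ there is $\lambda>0$ such that $\langle F(y,z)-B_r^{-1}g,z\rangle\ge0$ for all $y\in Y_0$ and all $z\in L^p(\Omega)$ with $\|z\|_{L^p(\Omega)}>\lambda$. 4. (Compactness.) If $y_k\rightharpoonup y$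 weakly in $W_0^{1,p}(\Omega)$, then $F(y_k,z)\to F(y,z)$ strongly in $L^q(\Omega)$ for every $z\in L^p(\Omega)$. 5. ($\mathfrak M$) If $y_k\to y$ strongly in $W_0^{1,p}(\Omega)$, $z_k\rightharpoonup z$ weakly in $L^p(\Omega)$ and $\lim_{k\to\infty}\langle F(y_k,z_k),z_k\rangle=\langle F(y,z),z\rangle$, then $z_k\to z$ strongly in $L^p(\Omega)$. 6. ($\mathfrak A$) If $y_k\to y$ strongly in $W_0^{1,p}(\Omega)$ and $z_k\rightharpoonup z$ weakly in $L^p(\Omega)$, then $\liminf_{k\to\infty}\langle F(y_k,z_k),z_k\rangle\ge\langle F(y,z),z\rangle$. For $y\in W_0^{1,p}(\Omega)$ let $\mathcal H(y)$ be the set of all $z\in L^p(\Omega)$ with $z+BF(y,z)=g$ in the sense of distributions on $\Omega$. Then, if $y_k\to y_0$ strongly in $W_0^{1,p}(\Omega)$ and $z_k\in\mathcal H(y_k)$ for all $k\in\mathbb N$, the sequence $\{z_k\}$ is relatively compact in the strong topology of $L^p(\Omega)$, and there are an element $z_0\in\mathcal H(y_0)$ and a subsequence of $\{z_k\}$ that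 converges to $z_0$ strongly in $L^p(\Omega)$. -/

import Mathlib

open MeasureTheory Filter Topology
open scoped ENNReal ContDiff

noncomputable section

namespace Hammerstein

/-! ### Lebesgue and Sobolev spaces on an open set `Ω ⊆ ℝᴺ` -/

/-- `ℝᴺ` with its Euclidean norm. -/
abbrev RN (N : ℕ) : Type := EuclideanSpace ℝ (Fin N)

/-- The (real) Lebesgue space `Lᵖ(Ω)`. -/
abbrev LpOn {N : ℕ} (Ω : Set (RN N)) (p : ℝ≥0∞) : Type :=
  Lp ℝ p ((volume : Measure (RN N)).restrict Ω)

/-- `φ ∈ C₀^∞(Ω)`: smooth, with compact support contained in `Ω`. -/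
def IsTestFunction {N : ℕ} (Ω : Set (RN N)) (φ : RN N → ℝ) : Prop :=
  ContDiff ℝ ∞ φ ∧ HasCompactSupport φ ∧ tsupport φ ⊆ Ω

/-- The classical partial derivative `∂φ/∂xᵢ` at `x`. -/
def partialDeriv {N : ℕ} (i : Fin N) (φ : RN N → ℝ) (x : RN N) : ℝ :=
  fderiv ℝ φ x (EuclideanSpace.single i 1)

/-- `v ∈ Lᵖ(Ω)` is the weak `i`-th partial derivative of `u ∈ Lᵖ(Ω)` on `Ω`. -/
def IsWeakPartialDeriv {N : ℕ} (Ω : Set (RN N)) {p : ℝ≥0∞} (i : Fin N)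
    (u v : LpOn Ω p) : Prop :=
  ∀ φ : RN N → ℝ, IsTestFunction Ω φ →
    ∫ x in Ω, u x * partialDeriv i φ x = - ∫ x in Ω, v x * φ x

/-- The space `Lᵖ(Ω) × Lᵖ(Ω)ᴺ` of pairs `(y, (v₁, …, v_N))` with the norm
`(‖y‖_p ^ p + ∑ᵢ ‖vᵢ‖_p ^ p) ^ (1 / p)`. -/
abbrev LpGrad {N : ℕ} (Ω : Set (RN N)) (p : ℝ≥0∞) : Type :=
  WithLp p (LpOn Ω p × PiLp p (fun _ : Fin N => LpOn Ω p))

section TestFunctions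

variable {N : ℕ} {Ω : Set (RN N)}

theorem IsTestFunction.zero : IsTestFunction Ω (fun _ => 0) :=
  ⟨contDiff_const, HasCompactSupport.zero,
    by rw [show (fun _ : RN N => (0 : ℝ)) = 0 from rfl, tsupport_zero]; exact Set.empty_subset _⟩

theorem IsTestFunction.add {φ ψ : RN N → ℝ} (hφ : IsTestFunction Ω φ)
    (hψ : IsTestFunction Ω ψ) : IsTestFunction Ω (φ + ψ) :=
  ⟨hφ.1.add hψ.1, hφ.2.1.add hψ.2.1,
    (tsupport_add φ ψ).trans (Set.union_subset hφ.2.2 hψ.2.2)⟩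

theorem IsTestFunction.const_smul {φ : RN N → ℝ} (c : ℝ) (hφ : IsTestFunction Ω φ) :
    IsTestFunction Ω (c • φ) :=
  ⟨hφ.1.const_smul c, hφ.2.1.smul_left (f := fun _ => c),
    (tsupport_smul_subset_right (fun _ : RN N => c) φ).trans hφ.2.2⟩

/-- A function in `Lᵖ(Ω)`, `p ≥ 1`, times a compactly supported continuous function is
integrable. -/
theorem integrable_mul_of_hasCompactSupport {p : ℝ≥0∞} [Fact (1 ≤ p)] (u : LpOn Ω p)
    {ψ : RN N → ℝ} (hψ : Continuous ψ) (hc : HasCompactSupport ψ) :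
    Integrable (fun x => u x * ψ x) ((volume : Measure (RN N)).restrict Ω) := by
  have h := ((Lp.memLp u).locallyIntegrable (Fact.out : 1 ≤ p)).integrable_smul_left_of_hasCompactSupport hψ hc
  refine h.congr (Eventually.of_forall fun x => ?_)
  simp [mul_comm]

theorem IsTestFunction.continuous_partialDeriv {φ : RN N → ℝ} (hφ : IsTestFunction Ω φ)
    (i : Fin N) : Continuous (partialDeriv i φ) :=
  (hφ.1.continuous_fderiv (by simp)).clm_apply continuous_const

theorem IsTestFunction.hasCompactSupport_partialDeriv {φ : RN N → ℝ}
    (hφ : IsTestFunction Ω φ) (i : Fin N) : HasCompactSupport (partialDeriv i φ) :=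
  hφ.2.1.fderiv_apply ℝ (EuclideanSpace.single i 1)

theorem IsWeakPartialDeriv.zero {p : ℝ≥0∞} (i : Fin N) :
    IsWeakPartialDeriv Ω i (0 : LpOn Ω p) 0 := by
  intro φ _
  have h0 := Lp.coeFn_zero ℝ p ((volume : Measure (RN N)).restrict Ω)
  have h1 : ∀ ψ : RN N → ℝ, ∫ x in Ω, (0 : LpOn Ω p) x * ψ x = 0 := by
    intro ψ
    rw [integral_congr_ae (g := fun _ => (0 : ℝ)) (by
      filter_upwards [h0] with x hx
      rw [hx, Pi.zero_apply, zero_mul])]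
    simp
  rw [h1, h1, neg_zero]

theorem IsWeakPartialDeriv.add {p : ℝ≥0∞} [Fact (1 ≤ p)] {i : Fin N} {u v u' v' : LpOn Ω p}
    (h : IsWeakPartialDeriv Ω i u v) (h' : IsWeakPartialDeriv Ω i u' v') :
    IsWeakPartialDeriv Ω i (u + u') (v + v') := by
  intro φ hφ
  have key : ∀ (a b : LpOn Ω p) (ψ : RN N → ℝ), Continuous ψ → HasCompactSupport ψ →
      ∫ x in Ω, (a + b) x * ψ x = (∫ x in Ω, a x * ψ x) + ∫ x in Ω, b x * ψ x := by
    intro a b ψ hψ hc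
    rw [← integral_add (integrable_mul_of_hasCompactSupport a hψ hc)
      (integrable_mul_of_hasCompactSupport b hψ hc)]
    refine integral_congr_ae ?_
    filter_upwards [Lp.coeFn_add a b] with x hx
    rw [hx, Pi.add_apply, add_mul]
  rw [key u u' _ (hφ.continuous_partialDeriv i) (hφ.hasCompactSupport_partialDeriv i),
    key v v' _ hφ.1.continuous hφ.2.1, h φ hφ, h' φ hφ, neg_add]

theorem IsWeakPartialDeriv.const_smul {p : ℝ≥0∞} {i : Fin N} {u v : LpOn Ω p} (c : ℝ)
    (h : IsWeakPartialDeriv Ω i u v) : IsWeakPartialDeriv Ω i (c • u) (c • v) := by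
  intro φ hφ
  have key : ∀ (a : LpOn Ω p) (ψ : RN N → ℝ),
      ∫ x in Ω, (c • a) x * ψ x = c * ∫ x in Ω, a x * ψ x := by
    intro a ψ
    rw [← integral_const_mul]
    refine integral_congr_ae ?_
    filter_upwards [Lp.coeFn_smul c a] with x hx
    rw [hx, Pi.smul_apply, smul_eq_mul, mul_assoc]
  rw [key, key, h φ hφ, mul_neg]

end TestFunctions

/-- The Sobolev space `W^{1,p}(Ω)`: an element is a function `y ∈ Lᵖ(Ω)` together with its weak
gradient in `Lᵖ(Ω)ᴺ` (which `y` determines), and the norm is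
`(∫_Ω ∑ᵢ |∂y/∂xᵢ| ^ p + ∫_Ω |y| ^ p) ^ (1 / p)`. -/
def W1p {N : ℕ} (Ω : Set (RN N)) (p : ℝ≥0∞) [Fact (1 ≤ p)] : Submodule ℝ (LpGrad Ω p) where
  carrier := {w | ∀ i : Fin N, IsWeakPartialDeriv Ω i w.fst (w.snd i)}
  zero_mem' := fun i => IsWeakPartialDeriv.zero i
  add_mem' := fun ha hb i => (ha i).add (hb i)
  smul_mem' := fun c _ ha i => (ha i).const_smul c

/-- `C₀^∞(Ω)` as a subspace of `W^{1,p}(Ω)`. -/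
def testSubspace {N : ℕ} (Ω : Set (RN N)) (p : ℝ≥0∞) [Fact (1 ≤ p)] :
    Submodule ℝ (W1p Ω p) where
  carrier := {w | ∃ φ : RN N → ℝ, IsTestFunction Ω φ ∧
    w.1.fst =ᵐ[(volume : Measure (RN N)).restrict Ω] φ}
  zero_mem' := ⟨fun _ => 0, IsTestFunction.zero, Lp.coeFn_zero ℝ p _⟩
  add_mem' := by
    rintro a b ⟨φ, hφ, ha⟩ ⟨ψ, hψ, hb⟩
    exact ⟨φ + ψ, hφ.add hψ, (Lp.coeFn_add a.1.fst b.1.fst).trans (ha.add hb)⟩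
  smul_mem' := by
    rintro c a ⟨φ, hφ, ha⟩
    exact ⟨c • φ, hφ.const_smul c, (Lp.coeFn_smul c a.1.fst).trans (ha.const_smul c)⟩

/-- `W₀^{1,p}(Ω)`: the closure of `C₀^∞(Ω)` in `W^{1,p}(Ω)`, with the norm of `W^{1,p}(Ω)`. -/
abbrev W01p {N : ℕ} (Ω : Set (RN N)) (p : ℝ≥0∞) [Fact (1 ≤ p)] : Submodule ℝ (W1p Ω p) :=
  (testSubspace Ω p).topologicalClosure

/-! ### Convergence and duality -/

/-- Weak convergence of a sequence in a normed space. -/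
def WeaklyConverges {E : Type*} [NormedAddCommGroup E] [NormedSpace ℝ E]
    (u : ℕ → E) (x : E) : Prop :=
  ∀ ℓ : E →L[ℝ] ℝ, Tendsto (fun k => ℓ (u k)) atTop (𝓝 (ℓ x))

/-- The pairing `⟨v, z⟩ = ∫_Ω v z dx` of `v ∈ L^q(Ω)` with `z ∈ Lᵖ(Ω)`. -/
def pairing {N : ℕ} {Ω : Set (RN N)} {p q : ℝ≥0∞} (v : LpOn Ω q) (z : LpOn Ω p) : ℝ :=
  ∫ x in Ω, v x * z x

/-- A seminorm on a normed space is compact with respect to the norm if every norm-bounded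
sequence has a subsequence that is Cauchy for the seminorm. -/
def IsCompactSeminorm {Z : Type*} [NormedAddCommGroup Z] [NormedSpace ℝ Z]
    (s : Seminorm ℝ Z) : Prop :=
  ∀ u : ℕ → Z, (∃ M : ℝ, ∀ k, ‖u k‖ ≤ M) →
    ∃ θ : ℕ → ℕ, StrictMono θ ∧
      ∀ ε > 0, ∃ n₀ : ℕ, ∀ m ≥ n₀, ∀ n ≥ n₀, s (u (θ m) - u (θ n)) < ε

/-! ### Properties of operators -/

section Operators

variable {N : ℕ} {Ω : Set (RN N)} {p q : ℝ≥0∞}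

/-- `G : Lᵖ(Ω) → L^q(Ω)` is radially continuous. -/
def RadiallyContinuous [Fact (1 ≤ p)] (G : LpOn Ω p → LpOn Ω q) : Prop :=
  ∀ z₁ z₂ : LpOn Ω p, ∃ ε : ℝ, 0 < ε ∧
    ContinuousOn (fun τ : ℝ => pairing (G (z₁ + τ • z₂)) z₂) (Set.Icc 0 ε)

variable {Y : Type*} [NormedAddCommGroup Y] [NormedSpace ℝ Y]

/-- `G : Y × Lᵖ(Ω) → L^q(Ω)` has uniformly semi-bounded variation. The infimum is taken in the
extended reals, so that it is `-∞` if the family `C_y(R; t)`, `y ∈ Y₀`, is not bounded below. -/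
def HasUSBV [Fact (1 ≤ p)] (G : Y → LpOn Ω p → LpOn Ω q) : Prop :=
  ∀ Y₀ : Set Y, Bornology.IsBounded Y₀ →
    ∃ (C : Y → ℝ → ℝ → ℝ) (s : Seminorm ℝ (LpOn Ω p)),
      IsCompactSeminorm s ∧
      (∀ y ∈ Y₀, ContinuousOn (fun a : ℝ × ℝ => C y a.1 a.2) (Set.Ici 0 ×ˢ Set.Ici 0)) ∧
      (∀ y ∈ Y₀, ∀ r : ℝ, 0 < r → Tendsto (fun t : ℝ => (1 / t) * C y r t) (𝓝[>] 0) (𝓝 0)) ∧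
      ∀ (R : ℝ) (z₁ z₂ : LpOn Ω p), ‖z₁‖ ≤ R → ‖z₂‖ ≤ R → ∀ y ∈ Y₀,
        -(⨅ y' ∈ Y₀, ((C y' R (s (z₁ - z₂)) : ℝ) : EReal)) ≤
          ((pairing (G y z₁ - G y z₂) (z₁ - z₂) : ℝ) : EReal)

/-- The `𝔐`-property of `G : Y × Lᵖ(Ω) → L^q(Ω)`. -/
def HasMProperty [Fact (1 ≤ p)] (G : Y → LpOn Ω p → LpOn Ω q) : Prop :=
  ∀ (y : ℕ → Y) (z : ℕ → LpOn Ω p) (y₀ : Y) (z₀ : LpOn Ω p),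
    Tendsto y atTop (𝓝 y₀) → WeaklyConverges z z₀ →
    Tendsto (fun k => pairing (G (y k) (z k)) (z k)) atTop (𝓝 (pairing (G y₀ z₀) z₀)) →
    Tendsto z atTop (𝓝 z₀)

/-- The `𝔄`-property of `G : Y × Lᵖ(Ω) → L^q(Ω)`, with the lower limit in the extended
reals. -/
def HasAProperty [Fact (1 ≤ p)] (G : Y → LpOn Ω p → LpOn Ω q) : Prop :=
  ∀ (y : ℕ → Y) (z : ℕ → LpOn Ω p) (y₀ : Y) (z₀ : LpOn Ω p),
    Tendsto y atTop (𝓝 y₀) → WeaklyConverges z z₀ →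
    ((pairing (G y₀ z₀) z₀ : ℝ) : EReal) ≤
      liminf (fun k => ((pairing (G (y k) (z k)) (z k) : ℝ) : EReal)) atTop

/-- `G` is compact in its first argument: `y_k ⇀ y₀` weakly in `Y` implies
`G(y_k, z) → G(y₀, z)` strongly in `L^q(Ω)`, for every `z`. -/
def IsCompactInFirstArg [Fact (1 ≤ q)] (G : Y → LpOn Ω p → LpOn Ω q) : Prop :=
  ∀ (z : LpOn Ω p) (y : ℕ → Y) (y₀ : Y), WeaklyConverges y y₀ →
    Tendsto (fun k => G (y k) z) atTop (𝓝 (G y₀ z))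

/-- The set `𝓗(y)` of all `z ∈ Lᵖ(Ω)` that solve `z + B F(y, z) = g` in the sense of
distributions on `Ω`. -/
def solutionSet [Fact (1 ≤ p)] [Fact (1 ≤ q)] (B : LpOn Ω q →L[ℝ] LpOn Ω p)
    (F : Y → LpOn Ω p → LpOn Ω q) (g : LpOn Ω p) (y : Y) : Set (LpOn Ω p) :=
  {z | ∀ φ : RN N → ℝ, IsTestFunction Ω φ →
    (∫ x in Ω, z x * φ x) + ∫ x in Ω, B (F y z) x * φ x = ∫ x in Ω, g x * φ x}

end Operators

end Hammerstein

end

namespace MeasureTheory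

section LpDual

variable {α : Type*} [MeasurableSpace α] {μ : Measure α} [IsFiniteMeasure μ]

/-- The indicators of disjoint sets sum up to the indicator of their union, in `Lᵖ`, `p < ∞`. -/
theorem hasSum_indicatorConstLp_iUnion {p : ℝ≥0∞} [Fact (1 ≤ p)] (hp : p ≠ ⊤) {A : ℕ → Set α}
    (hA : ∀ i, MeasurableSet (A i)) (hd : Pairwise (Function.onFun Disjoint A)) :
    HasSum (fun i => indicatorConstLp p (hA i) (measure_ne_top μ (A i)) (1 : ℝ))
      (indicatorConstLp p (MeasurableSet.iUnion hA) (measure_ne_top μ (⋃ i, A i)) (1 : ℝ)) := by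
  have hsum : ∀ F : Finset ℕ,
      ∑ i ∈ F, indicatorConstLp p (hA i) (measure_ne_top μ (A i)) (1 : ℝ) =
        indicatorConstLp p (F.measurableSet_biUnion fun i _ => hA i)
          (measure_ne_top μ (⋃ i ∈ F, A i)) (1 : ℝ) := by
    intro F
    classical
    induction F using Finset.induction_on with
    | empty => simp [indicatorConstLp_empty]
    | insert a F ha ih =>
      rw [Finset.sum_insert ha, ih]
      have hdis : Disjoint (A a) (⋃ i ∈ F, A i) := by
        simp only [Set.disjoint_iUnion_right]
        exact fun i hi => hd (fun h => ha (h ▸ hi))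
      rw [← indicatorConstLp_disjoint_union (hA a) (F.measurableSet_biUnion fun i _ => hA i)
        (measure_ne_top μ _) (measure_ne_top μ _) hdis]
      congr 1
      simp
  rw [HasSum]
  simp only [hsum]
  refine tendsto_indicatorConstLp_set hp ?_
  have hμ : HasSum (fun i => μ (A i)) (μ (⋃ i, A i)) := by
    rw [measure_iUnion hd hA]
    exact ENNReal.summable.hasSum
  have key : ∀ F : Finset ℕ, μ (symmDiff (⋃ i ∈ F, A i) (⋃ i, A i)) =
      μ (⋃ i, A i) - ∑ i ∈ F, μ (A i) := by
    intro F
    have hsub : (⋃ i ∈ F, A i) ⊆ ⋃ i, A i := Set.iUnion₂_subset fun i _ => Set.subset_iUnion A i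
    rw [symmDiff_of_le hsub, measure_sdiff hsub
      (F.measurableSet_biUnion fun i _ => hA i).nullMeasurableSet (measure_ne_top μ _),
      measure_biUnion_finset (fun i _ j _ hij => hd hij) (fun i _ => hA i)]
  simp only [key]
  have := ENNReal.Tendsto.sub (tendsto_const_nhds (x := μ (⋃ i, A i))) hμ
    (Or.inl (measure_ne_top μ _))
  simpa using this

/-- A continuous functional on `Lᵖ`, `p < ∞`, is given on indicators by an integrable density. -/
theorem exists_density_of_clm_Lp {p : ℝ≥0∞} [Fact (1 ≤ p)] (hp : p ≠ ⊤)
    (ℓ : Lp ℝ p μ →L[ℝ] ℝ) :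
    ∃ f : α → ℝ, Measurable f ∧ Integrable f μ ∧ ∀ (A : Set α) (hA : MeasurableSet A),
      ℓ (indicatorConstLp p hA (measure_ne_top μ A) 1) = ∫ x in A, f x ∂μ := by
  classical
  let ν : SignedMeasure α :=
    { measureOf' := fun A =>
        if hA : MeasurableSet A then ℓ (indicatorConstLp p hA (measure_ne_top μ A) 1) else 0
      empty' := by simp [indicatorConstLp_empty]
      not_measurable' := fun A hA => by simp [hA]
      m_iUnion' := fun A hA hd => by
        have h := (hasSum_indicatorConstLp_iUnion (μ := μ) hp hA hd).mapL ℓ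
        simpa only [hA, MeasurableSet.iUnion hA, dif_pos] using h }
  have hν : ∀ (A : Set α) (hA : MeasurableSet A),
      ν A = ℓ (indicatorConstLp p hA (measure_ne_top μ A) 1) := fun A hA => dif_pos hA
  have hac : ν ≪ᵥ μ.toENNRealVectorMeasure := by
    refine VectorMeasure.AbsolutelyContinuous.mk fun A hA h0 => ?_
    rw [Measure.toENNRealVectorMeasure_apply_measurable hA] at h0
    have : indicatorConstLp p hA (measure_ne_top μ A) (1 : ℝ) = 0 := by
      rw [← indicatorConstLp_empty (p := p) (μ := μ) (c := (1 : ℝ)),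
        indicatorConstLp_inj _ _ _ _ one_ne_zero]
      exact ae_eq_empty.2 h0
    rw [hν A hA, this, map_zero]
  refine ⟨ν.rnDeriv μ, SignedMeasure.measurable_rnDeriv ν μ,
    SignedMeasure.integrable_rnDeriv ν μ, fun A hA => ?_⟩
  rw [← hν A hA, ← withDensityᵥ_apply (SignedMeasure.integrable_rnDeriv ν μ) hA,
    SignedMeasure.withDensityᵥ_rnDeriv_eq ν μ hac]

/-- Continuous functionals on `Lᵖ`, `p < ∞`, that agree on indicators are equal. -/
theorem clm_Lp_ext_indicator {p : ℝ≥0∞} [Fact (1 ≤ p)] (hp : p ≠ ⊤)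
    {ℓ ℓ' : Lp ℝ p μ →L[ℝ] ℝ}
    (h : ∀ (A : Set α) (hA : MeasurableSet A),
      ℓ (indicatorConstLp p hA (measure_ne_top μ A) 1) =
        ℓ' (indicatorConstLp p hA (measure_ne_top μ A) 1)) : ℓ = ℓ' := by
  ext g
  refine Lp.induction hp (fun g => ℓ g = ℓ' g) ?_ ?_ ?_ g
  · intro c A hA hμA
    have : (Lp.simpleFunc.indicatorConst p hA hμA.ne c : Lp ℝ p μ) =
        c • indicatorConstLp p hA (measure_ne_top μ A) 1 := by
      rw [Lp.simpleFunc.coe_indicatorConst, indicatorConstLp, indicatorConstLp,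
        ← MemLp.toLp_const_smul]
      refine MemLp.toLp_congr _ _ (Eventually.of_forall fun x => ?_)
      by_cases hx : x ∈ A <;> simp [hx]
    simp only [this, map_smul, h A hA]
  · intro f g hf hg _ h1 h2
    simp only [map_add, h1, h2]
  · exact isClosed_eq ℓ.continuous ℓ'.continuous

/-- A bounded function is bounded in `L^σ` by its norm as a functional on `L^ρ`. -/
theorem eLpNorm_le_of_forall_integral_mul_le {ρ σ : ℝ} (hσρ : σ.HolderConjugate ρ) {f : α → ℝ}
    (hf : Measurable f) {C K : ℝ} (hK : 0 ≤ K) (hC : ∀ x, |f x| ≤ C)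
    (h : ∀ g : α → ℝ, MemLp g (ENNReal.ofReal ρ) μ →
      ∫ x, f x * g x ∂μ ≤ K * (eLpNorm g (ENNReal.ofReal ρ) μ).toReal) :
    eLpNorm f (ENNReal.ofReal σ) μ ≤ ENNReal.ofReal K := by
  have hσ := hσρ.lt
  have hσ0 : ENNReal.ofReal σ ≠ 0 := by simpa using hσρ.pos
  have hρ0 : ENNReal.ofReal ρ ≠ 0 := by simpa using hσρ.symm.pos
  set g : α → ℝ := fun x => Real.sign (f x) * |f x| ^ (σ - 1) with hg
  have hsm : Measurable Real.sign :=
    Measurable.ite measurableSet_Iio measurable_const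
      (Measurable.ite measurableSet_Ioi measurable_const measurable_const)
  have hgm : Measurable g := (hsm.comp hf).mul (hf.abs.pow_const _)
  have hgabs : ∀ x, |g x| = |f x| ^ (σ - 1) := by
    intro x
    rcases lt_trichotomy (f x) 0 with h0 | h0 | h0
    · simp only [hg, Real.sign_of_neg h0, neg_one_mul, abs_neg]
      exact abs_of_nonneg (by positivity)
    · simp [hg, h0, Real.zero_rpow (sub_pos.2 hσ).ne']
    · simp only [hg, Real.sign_of_pos h0, one_mul]
      exact abs_of_nonneg (by positivity)
  have hgL : MemLp g (ENNReal.ofReal ρ) μ := by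
    refine MemLp.of_bound hgm.aestronglyMeasurable (C ^ (σ - 1)) (Eventually.of_forall fun x => ?_)
    rw [Real.norm_eq_abs, hgabs]
    exact Real.rpow_le_rpow (abs_nonneg _) (hC x) (sub_pos.2 hσ).le
  have hfL : MemLp f (ENNReal.ofReal σ) μ :=
    MemLp.of_bound hf.aestronglyMeasurable C (Eventually.of_forall hC)
  have hfg : ∀ x, f x * g x = |f x| ^ σ := by
    intro x
    have hpow : 0 < |f x| → |f x| * |f x| ^ (σ - 1) = |f x| ^ σ := fun h0 => by
      rw [Real.rpow_sub_one h0.ne']; field_simp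
    rcases lt_trichotomy (f x) 0 with h0 | h0 | h0
    · rw [← hpow (abs_pos.2 h0.ne)]
      simp only [hg, Real.sign_of_neg h0]
      rw [abs_of_neg h0]; ring
    · simp [hg, h0, Real.zero_rpow hσρ.pos.ne']
    · rw [← hpow (abs_pos.2 h0.ne')]
      simp only [hg, Real.sign_of_pos h0]
      rw [abs_of_pos h0]; ring
  have hgρ : ∀ x, |g x| ^ ρ = |f x| ^ σ := by
    intro x
    rw [hgabs, ← Real.rpow_mul (abs_nonneg _), hσρ.sub_one_mul_conj]
  have hI0 : 0 ≤ ∫ x, |f x| ^ σ ∂μ := integral_nonneg fun x => by positivity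
  have h1 := h g hgL
  rw [hgL.eLpNorm_eq_integral_rpow_norm hρ0 ENNReal.ofReal_ne_top,
    ENNReal.toReal_ofReal (by positivity), ENNReal.toReal_ofReal hσρ.symm.nonneg] at h1
  simp only [Real.norm_eq_abs, hfg, hgρ] at h1
  rw [hfL.eLpNorm_eq_integral_rpow_norm hσ0 ENNReal.ofReal_ne_top,
    ENNReal.toReal_ofReal hσρ.nonneg]
  simp only [Real.norm_eq_abs]
  refine ENNReal.ofReal_le_ofReal ?_
  set I := ∫ x, |f x| ^ σ ∂μ
  rcases hI0.eq_or_lt with h0 | h0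
  · rw [← h0, Real.zero_rpow (inv_pos.2 hσρ.pos).ne']
    exact hK
  · have h2 : I ^ σ⁻¹ * I ^ ρ⁻¹ = I := by
      rw [← Real.rpow_add h0, hσρ.inv_add_inv_eq_one, Real.rpow_one]
    refine le_of_mul_le_mul_right ?_ (Real.rpow_pos_of_pos h0 ρ⁻¹)
    rwa [h2]

/-- The product of the indicators of two sets is the indicator of their intersection. -/
theorem indicatorConstLp_top_holder {p : ℝ≥0∞} {E A : Set α} (hE : MeasurableSet E)
    (hA : MeasurableSet A) :
    (ContinuousLinearMap.mul ℝ ℝ).holder p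
        (indicatorConstLp ⊤ hE (measure_ne_top μ E) (1 : ℝ))
        (indicatorConstLp p hA (measure_ne_top μ A) (1 : ℝ)) =
      indicatorConstLp p (hE.inter hA) (measure_ne_top μ (E ∩ A)) 1 := by
  ext1
  filter_upwards [(ContinuousLinearMap.mul ℝ ℝ).coeFn_holder (r := p)
      (indicatorConstLp ⊤ hE (measure_ne_top μ E) (1 : ℝ))
      (indicatorConstLp p hA (measure_ne_top μ A) (1 : ℝ)),
    indicatorConstLp_coeFn (p := ⊤) (hs := hE) (hμs := measure_ne_top μ E) (c := (1 : ℝ)),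
    indicatorConstLp_coeFn (p := p) (hs := hA) (hμs := measure_ne_top μ A) (c := (1 : ℝ)),
    indicatorConstLp_coeFn (p := p) (hs := hE.inter hA) (hμs := measure_ne_top μ (E ∩ A))
      (c := (1 : ℝ))] with x h1 h2 h3 h4
  rw [h1, h2, h3, h4]
  by_cases hxE : x ∈ E <;> by_cases hxA : x ∈ A <;> simp [hxE, hxA]

theorem integral_mul_indicatorConstLp {p : ℝ≥0∞} (f : α → ℝ) {A : Set α} (hA : MeasurableSet A) :
    ∫ x, f x * indicatorConstLp p hA (measure_ne_top μ A) (1 : ℝ) x ∂μ = ∫ x in A, f x ∂μ := by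
  rw [← integral_indicator hA]
  refine integral_congr_ae ?_
  filter_upwards [indicatorConstLp_coeFn (p := p) (hs := hA) (hμs := measure_ne_top μ A)
    (c := (1 : ℝ))] with x hx
  rw [hx]
  by_cases hxA : x ∈ A <;> simp [hxA]

/-- Riesz representation: for conjugate exponents `1 < p, q < ∞`, every continuous functional on
`Lᵖ` is the pairing with a function in `L^q`. -/
theorem exists_lpPairing_eq {p q : ℝ≥0∞} [Fact (1 ≤ p)] [Fact (1 ≤ q)]
    [hqp : ENNReal.HolderConjugate q p] (hp : p ≠ ⊤) (hq : q ≠ ⊤) (ℓ : Lp ℝ p μ →L[ℝ] ℝ) :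
    ∃ f : Lp ℝ q μ, (ContinuousLinearMap.mul ℝ ℝ).lpPairing μ q p f = ℓ := by
  obtain ⟨f, hfm, hfi, hf⟩ := exists_density_of_clm_Lp hp ℓ
  have hρ : ENNReal.ofReal p.toReal = p := ENNReal.ofReal_toReal hp
  have hσ : ENNReal.ofReal q.toReal = q := ENNReal.ofReal_toReal hq
  have hσρ : q.toReal.HolderConjugate p.toReal := by
    have := ENNReal.HolderTriple.toReal 1
      (ENNReal.toReal_pos (zero_lt_one.trans_le (Fact.out : 1 ≤ q)).ne' hq)
      (ENNReal.toReal_pos (zero_lt_one.trans_le (Fact.out : 1 ≤ p)).ne' hp)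
    rwa [ENNReal.toReal_one] at this
  let E : ℕ → Set α := fun n => {x | |f x| ≤ n}
  have hE : ∀ n, MeasurableSet (E n) := fun n => measurableSet_le hfm.abs measurable_const
  let F : ℕ → α → ℝ := fun n => (E n).indicator f
  have hFm : ∀ n, Measurable (F n) := fun n => hfm.indicator (hE n)
  have hFb : ∀ n x, |F n x| ≤ n := by
    intro n x
    by_cases hx : x ∈ E n
    · simp only [F, Set.indicator_of_mem hx]
      exact hx
    · simp [F, Set.indicator_of_notMem hx]
  have hFL : ∀ n, MemLp (F n) q μ := fun n =>
    MemLp.of_bound (hFm n).aestronglyMeasurable n (Eventually.of_forall (hFb n))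
  have hrep : ∀ n, (ContinuousLinearMap.mul ℝ ℝ).lpPairing μ q p ((hFL n).toLp (F n)) =
      ℓ.comp ((ContinuousLinearMap.mul ℝ ℝ).holderL μ ⊤ p p
        (indicatorConstLp ⊤ (hE n) (measure_ne_top μ _) (1 : ℝ))) := by
    intro n
    refine clm_Lp_ext_indicator hp fun A hA => ?_
    rw [ContinuousLinearMap.comp_apply, ContinuousLinearMap.holderL_apply_apply,
      indicatorConstLp_top_holder, hf _ ((hE n).inter hA), ContinuousLinearMap.lpPairing_eq_integral]
    simp only [ContinuousLinearMap.mul_apply']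
    rw [integral_mul_indicatorConstLp, Set.inter_comm, ← setIntegral_indicator (hE n)]
    exact integral_congr_ae (ae_restrict_of_ae (hFL n).coeFn_toLp)
  have hbound : ∀ n, eLpNorm (F n) q μ ≤ ENNReal.ofReal ‖ℓ‖ := by
    intro n
    rw [← hσ]
    refine eLpNorm_le_of_forall_integral_mul_le hσρ (hFm n) (norm_nonneg ℓ) (hFb n) ?_
    rw [hρ]
    intro g hg
    have h1 := DFunLike.congr_fun (hrep n) (hg.toLp g)
    rw [ContinuousLinearMap.lpPairing_eq_integral] at h1
    have h2 : ∫ x, F n x * g x ∂μ =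
        ∫ x, ContinuousLinearMap.mul ℝ ℝ ((hFL n).toLp (F n) x) (hg.toLp g x) ∂μ := by
      refine integral_congr_ae ?_
      filter_upwards [(hFL n).coeFn_toLp, hg.coeFn_toLp] with x h1 h2
      rw [h1, h2, ContinuousLinearMap.mul_apply']
    rw [h2, h1, ← Lp.norm_toLp g hg]
    refine (le_abs_self _).trans (ℓ.le_opNorm_of_le ?_)
    refine (ContinuousLinearMap.norm_holder_apply_apply_le _ _ _).trans ?_
    have h3 : ‖indicatorConstLp ⊤ (hE n) (measure_ne_top μ (E n)) (1 : ℝ)‖ ≤ 1 := by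
      refine norm_indicatorConstLp_le.trans ?_
      simp
    have h4 : ‖ContinuousLinearMap.mul ℝ ℝ‖ ≤ 1 := ContinuousLinearMap.opNorm_mul_le ℝ ℝ
    exact mul_le_of_le_one_left (norm_nonneg _) (mul_le_one₀ h4 (norm_nonneg _) h3)
  have hlim : ∀ x, Tendsto (fun n => F n x) atTop (𝓝 (f x)) := by
    intro x
    obtain ⟨n₀, hn₀⟩ := exists_nat_ge |f x|
    refine tendsto_const_nhds.congr' ?_
    filter_upwards [eventually_ge_atTop n₀] with n hn
    exact (Set.indicator_of_mem (show x ∈ E n from hn₀.trans (Nat.cast_le.2 hn)) f).symm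
  have hfL : MemLp f q μ := by
    refine ⟨hfm.aestronglyMeasurable, lt_of_le_of_lt
      (Lp.eLpNorm_lim_le_liminf_eLpNorm (fun n => (hFm n).aestronglyMeasurable) f
        (Eventually.of_forall hlim)) ?_⟩
    exact (liminf_le_of_le (by isBoundedDefault) fun b hb => by
      obtain ⟨n, hn⟩ := hb.exists
      exact hn.trans (hbound n)).trans_lt ENNReal.ofReal_lt_top
  refine ⟨hfL.toLp f, clm_Lp_ext_indicator hp fun A hA => ?_⟩
  rw [ContinuousLinearMap.lpPairing_eq_integral, hf A hA]
  simp only [ContinuousLinearMap.mul_apply']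
  rw [integral_mul_indicatorConstLp]
  exact integral_congr_ae (ae_restrict_of_ae hfL.coeFn_toLp)

/-- Sequences in `L^q`, `1 < q < ∞`, that are bounded as functionals on `Lᵖ` have weakly convergent
subsequences. -/
theorem exists_subseq_tendsto_lpPairing {p q : ℝ≥0∞} [Fact (1 ≤ p)] [Fact (1 ≤ q)]
    [hqp : ENNReal.HolderConjugate q p] [IsSeparable μ] (hp : p ≠ ⊤) (hq : q ≠ ⊤)
    {w : ℕ → Lp ℝ q μ} {K : ℝ}
    (hw : ∀ k, ‖(ContinuousLinearMap.mul ℝ ℝ).lpPairing μ q p (w k)‖ ≤ K) :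
    ∃ (w₀ : Lp ℝ q μ) (θ : ℕ → ℕ), StrictMono θ ∧ ∀ g : Lp ℝ p μ,
      Tendsto (fun k => (ContinuousLinearMap.mul ℝ ℝ).lpPairing μ q p (w (θ k)) g) atTop
        (𝓝 ((ContinuousLinearMap.mul ℝ ℝ).lpPairing μ q p w₀ g)) := by
  set P := (ContinuousLinearMap.mul ℝ ℝ).lpPairing μ q p
  have : Fact (p ≠ ⊤) := ⟨hp⟩
  obtain ⟨ℓ, -, θ, hθ, hlim⟩ := WeakDual.isSeqCompact_closedBall ℝ (Lp ℝ p μ) 0 K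
    (x := fun k => StrongDual.toWeakDual (P (w k))) (fun k => by simpa using hw k)
  obtain ⟨w₀, hw₀⟩ := exists_lpPairing_eq hp hq (WeakDual.toStrongDual ℓ)
  refine ⟨w₀, θ, hθ, fun g => ?_⟩
  have := (WeakDual.eval_continuous g).continuousAt.tendsto.comp hlim
  rw [hw₀]
  exact this

end LpDual

end MeasureTheory

namespace Hammerstein

section WeakConvergence

variable {E : Type*} [NormedAddCommGroup E] [NormedSpace ℝ E]

theorem WeaklyConverges.of_tendsto {u : ℕ → E} {x : E} (h : Tendsto u atTop (𝓝 x)) :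
    WeaklyConverges u x := fun ℓ => (ℓ.continuous.tendsto x).comp h

theorem WeaklyConverges.comp {u : ℕ → E} {x : E} (h : WeaklyConverges u x) {θ : ℕ → ℕ}
    (hθ : StrictMono θ) : WeaklyConverges (u ∘ θ) x :=
  fun ℓ => (h ℓ).comp hθ.tendsto_atTop

/-- Closed convex sets are weakly sequentially closed. -/
theorem WeaklyConverges.mem_of_isClosed_convex {u : ℕ → E} {x : E} (h : WeaklyConverges u x)
    {s : Set E} (hs : IsClosed s) (hc : Convex ℝ s) (hu : ∀ᶠ k in atTop, u k ∈ s) : x ∈ s := by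
  by_contra hx
  obtain ⟨f, a, hfs, hfx⟩ := geometric_hahn_banach_closed_point hc hs hx
  exact hfx.not_ge (le_of_tendsto (h f) (hu.mono fun k hk => (hfs _ hk).le))

/-- A compact seminorm is bounded with respect to the norm. -/
theorem IsCompactSeminorm.exists_bound {s : Seminorm ℝ E} (hs : IsCompactSeminorm s) :
    ∃ M : ℝ, 0 < M ∧ ∀ x, s x ≤ M * ‖x‖ := by
  by_contra! hM
  choose! x hx using fun n : ℕ => hM (n + 1) (by positivity)
  have hx0 : ∀ n, 0 < ‖x n‖ := by
    intro n
    rw [norm_pos_iff]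
    intro h0
    have := hx n
    simp [h0] at this
  obtain ⟨θ, hθ, hc⟩ := hs (fun n => ‖x n‖⁻¹ • x n) ⟨1, fun n => by
    rw [norm_smul, norm_inv, norm_norm, inv_mul_cancel₀ (hx0 n).ne']⟩
  have hlow : ∀ n : ℕ, (n : ℝ) < s (‖x n‖⁻¹ • x n) := by
    intro n
    rw [map_smul_eq_mul, norm_inv, norm_norm, inv_mul_eq_div, lt_div_iff₀ (hx0 n)]
    exact (mul_le_mul_of_nonneg_right (by linarith) (hx0 n).le).trans_lt (hx n)
  obtain ⟨n₀, hn₀⟩ := hc 1 one_pos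
  obtain ⟨m, hm⟩ := exists_nat_ge (1 + s (‖x (θ n₀)‖⁻¹ • x (θ n₀)))
  have h1 := hn₀ (max m n₀) (le_max_right _ _) n₀ le_rfl
  have h2 := hlow (θ (max m n₀))
  have h3 : (m : ℝ) ≤ θ (max m n₀) :=
    Nat.cast_le.2 ((le_max_left m n₀).trans (hθ.id_le _))
  have h4 := map_add_le_add s (‖x (θ (max m n₀))‖⁻¹ • x (θ (max m n₀)) - ‖x (θ n₀)‖⁻¹ • x (θ n₀))
    (‖x (θ n₀)‖⁻¹ • x (θ n₀))
  rw [sub_add_cancel] at h4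
  linarith

theorem IsCompactSeminorm.continuous {s : Seminorm ℝ E} (hs : IsCompactSeminorm s) :
    Continuous s := by
  obtain ⟨M, hM, h⟩ := hs.exists_bound
  refine Seminorm.continuous_of_le (q := M.toNNReal • normSeminorm ℝ E) ?_ fun x => ?_
  · exact (continuous_norm (E := E)).const_smul M.toNNReal
  · simpa [smul_apply, NNReal.smul_def, hM.le] using h x

/-- Along a weakly convergent sequence, a compact seminorm has a null subsequence. -/
theorem IsCompactSeminorm.exists_subseq_tendsto {s : Seminorm ℝ E} (hs : IsCompactSeminorm s)
    {u : ℕ → E} {x : E} (hb : ∃ M : ℝ, ∀ k, ‖u k‖ ≤ M) (hu : WeaklyConverges u x) :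
    ∃ θ : ℕ → ℕ, StrictMono θ ∧ Tendsto (fun k => s (u (θ k) - x)) atTop (𝓝 0) := by
  obtain ⟨θ, hθ, hc⟩ := hs u hb
  refine ⟨θ, hθ, Metric.tendsto_atTop.2 fun ε hε => ?_⟩
  obtain ⟨n₀, hn₀⟩ := hc (ε / 2) (half_pos hε)
  refine ⟨n₀, fun n hn => ?_⟩
  have hmem : x ∈ s.closedBall (u (θ n)) (ε / 2) := by
    refine (hu.comp hθ).mem_of_isClosed_convex ?_ (s.convex_closedBall _ _) ?_
    · have : s.closedBall (u (θ n)) (ε / 2) = {v | s (v - u (θ n)) ≤ ε / 2} := by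
        ext v; simp [Seminorm.mem_closedBall]
      rw [this]
      exact isClosed_le (hs.continuous.comp (continuous_id.sub continuous_const)) continuous_const
    · filter_upwards [eventually_ge_atTop n₀] with m hm
      exact s.mem_closedBall.2 (hn₀ m hm n hn).le
  rw [Seminorm.mem_closedBall, map_sub_rev] at hmem
  rw [Real.dist_eq, sub_zero, abs_of_nonneg (apply_nonneg s _)]
  linarith

end WeakConvergence

/-- If every subsequence of a sequence has a convergent subsequence, its range is relatively
compact. -/
theorem isCompact_closure_range_of_forall_subseq {X : Type*} [MetricSpace X] {z : ℕ → X}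
    (h : ∀ θ : ℕ → ℕ, StrictMono θ →
      ∃ (x : X) (η : ℕ → ℕ), StrictMono η ∧ Tendsto (z ∘ θ ∘ η) atTop (𝓝 x)) :
    IsCompact (closure (Set.range z)) := by
  refine IsSeqCompact.isCompact fun u hu => ?_
  have hpos : ∀ k : ℕ, (0 : ℝ) < 1 / (k + 1) := fun k => Nat.one_div_pos_of_nat
  have : ∀ k, ∃ n, dist (u k) (z n) < 1 / (k + 1) := fun k => by
    obtain ⟨_, ⟨n, rfl⟩, hn⟩ := Metric.mem_closure_iff.1 (hu k) _ (hpos k)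
    exact ⟨n, hn⟩
  choose n hn using this
  have key : ∃ (x : X) (φ : ℕ → ℕ), StrictMono φ ∧ Tendsto (z ∘ n ∘ φ) atTop (𝓝 x) := by
    obtain ⟨e, he⟩ := exists_increasing_or_nonincreasing_subseq (· < ·) n
    rcases he with he | he
    · obtain ⟨x, η, hη, hx⟩ := h (fun k => n (e k)) fun a b hab => he a b hab
      exact ⟨x, fun k => e (η k), e.strictMono.comp hη, hx⟩
    · obtain ⟨m, hm⟩ := (wellFounded_lt (α := ℕ)).has_min (Set.range (n ∘ e)) (Set.range_nonempty _)
      obtain ⟨⟨j, rfl⟩, hmin⟩ := hm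
      refine ⟨z (n (e j)), fun k => e (k + j), e.strictMono.comp fun a b hab => by simpa using hab,
        tendsto_const_nhds.congr' ?_⟩
      filter_upwards [eventually_gt_atTop 0] with k hk
      have h1 := he j (k + j) (by omega)
      have h2 := hmin (n (e (k + j))) ⟨k + j, rfl⟩
      have h3 : n (e (k + j)) = n (e j) := le_antisymm (not_lt.1 h1) (not_lt.1 h2)
      simp [h3]
  obtain ⟨x, φ, hφ, hx⟩ := key
  have hux : Tendsto (u ∘ φ) atTop (𝓝 x) := by
    refine (tendsto_iff_of_dist ?_).2 hx
    exact squeeze_zero (fun _ => dist_nonneg) (fun k => (hn (φ k)).le)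
      (tendsto_one_div_add_atTop_nhds_zero_nat.comp hφ.tendsto_atTop)
  exact ⟨x, isClosed_closure.mem_of_tendsto hux (Eventually.of_forall fun k => hu (φ k)), φ, hφ, hux⟩

section Pairing

/-- The pairing of `L^q(Ω)` with `Lᵖ(Ω)` as a continuous bilinear map. -/
noncomputable def dualPairing {N : ℕ} (Ω : Set (RN N)) (q p : ℝ≥0∞) [Fact (1 ≤ p)] [Fact (1 ≤ q)]
    [ENNReal.HolderConjugate q p] : LpOn Ω q →L[ℝ] LpOn Ω p →L[ℝ] ℝ :=
  (ContinuousLinearMap.mul ℝ ℝ).lpPairing ((volume : Measure (RN N)).restrict Ω) q p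

variable {N : ℕ} {Ω : Set (RN N)} {p q : ℝ≥0∞} [Fact (1 ≤ p)] [Fact (1 ≤ q)]

theorem pairing_eq_dualPairing [ENNReal.HolderConjugate q p] (v : LpOn Ω q) (z : LpOn Ω p) :
    pairing v z = dualPairing Ω q p v z := by
  rw [dualPairing, ContinuousLinearMap.lpPairing_eq_integral]
  rfl

theorem mem_solutionSet_iff {Y : Type*} [NormedAddCommGroup Y] [NormedSpace ℝ Y]
    (hΩ : IsOpen Ω) (B : LpOn Ω q →L[ℝ] LpOn Ω p)
    (F : Y → LpOn Ω p → LpOn Ω q) (g : LpOn Ω p) (y : Y) (z : LpOn Ω p) :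
    z ∈ solutionSet B F g y ↔ z + B (F y z) = g := by
  have hint : ∀ (u : LpOn Ω p) (φ : RN N → ℝ), IsTestFunction Ω φ →
      Integrable (fun x => u x * φ x) ((volume : Measure (RN N)).restrict Ω) :=
    fun u φ hφ => integrable_mul_of_hasCompactSupport u hφ.1.continuous hφ.2.1
  have hadd : ∀ (u v : LpOn Ω p) (φ : RN N → ℝ), IsTestFunction Ω φ →
      ∫ x in Ω, (u + v) x * φ x = (∫ x in Ω, u x * φ x) + ∫ x in Ω, v x * φ x := by
    intro u v φ hφ
    rw [← integral_add (hint u φ hφ) (hint v φ hφ)]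
    refine integral_congr_ae ?_
    filter_upwards [Lp.coeFn_add u v] with x hx
    rw [hx, Pi.add_apply, add_mul]
  constructor
  · intro hz
    set u := z + B (F y z) - g with hu
    have h0 : ∀ φ : RN N → ℝ, IsTestFunction Ω φ → ∫ x in Ω, u x * φ x = 0 := by
      intro φ hφ
      have h1 := hadd u g φ hφ
      rw [hu, sub_add_cancel, hadd _ _ φ hφ, hz φ hφ] at h1
      linarith
    have hloc : LocallyIntegrableOn (u : RN N → ℝ) Ω ((volume : Measure (RN N)).restrict Ω) :=
      ((Lp.memLp u).locallyIntegrable (Fact.out : 1 ≤ p)).locallyIntegrableOn Ω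
    have h2 := hΩ.ae_eq_zero_of_integral_contDiff_smul_eq_zero hloc fun φ h1 h2 h3 => by
      simpa only [smul_eq_mul, mul_comm] using h0 φ ⟨h1, h2, h3⟩
    have h3 : u = 0 := by
      ext1
      filter_upwards [h2, ae_restrict_mem hΩ.measurableSet, Lp.coeFn_zero ℝ p _] with x hx hxΩ h0
      rw [hx hxΩ, h0, Pi.zero_apply]
    exact sub_eq_zero.1 h3
  · intro hz φ hφ
    rw [← hadd _ _ φ hφ, hz]

end Pairing

section Operators

variable {N : ℕ} {Ω : Set (RN N)} {p q : ℝ≥0∞} [Fact (1 ≤ p)] [Fact (1 ≤ q)]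
  [ENNReal.HolderConjugate q p] {Y : Type*} [NormedAddCommGroup Y]

/-- Semi-bounded variation along a convergent sequence, with the bound taken at the limit. -/
theorem HasUSBV.exists_lower_bound {G : Y → LpOn Ω p → LpOn Ω q} (hG : HasUSBV G) {y : ℕ → Y}
    {y₀ : Y} (hy : Tendsto y atTop (𝓝 y₀)) :
    ∃ (c : ℝ → ℝ → ℝ) (s : Seminorm ℝ (LpOn Ω p)), IsCompactSeminorm s ∧
      (∀ R : ℝ, 0 ≤ R → ContinuousOn (c R) (Set.Ici 0)) ∧
      (∀ R : ℝ, 0 < R → Tendsto (fun t : ℝ => (1 / t) * c R t) (𝓝[>] 0) (𝓝 0)) ∧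
      ∀ (R : ℝ) (z₁ z₂ : LpOn Ω p), ‖z₁‖ ≤ R → ‖z₂‖ ≤ R → ∀ k,
        -c R (s (z₁ - z₂)) ≤ dualPairing Ω q p (G (y k) z₁ - G (y k) z₂) (z₁ - z₂) := by
  obtain ⟨C, s, hs, hC, hC0, h⟩ := hG (insert y₀ (Set.range y))
    ((Metric.isBounded_range_of_tendsto y hy).insert y₀)
  have hmem : y₀ ∈ insert y₀ (Set.range y) := Set.mem_insert _ _
  refine ⟨C y₀, s, hs, fun R hR => ?_, hC0 y₀ hmem, fun R z₁ z₂ h₁ h₂ k => ?_⟩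
  · exact (hC y₀ hmem).comp (f := fun t : ℝ => (R, t)) (by fun_prop) fun t ht => ⟨hR, ht⟩
  · have h3 := h R z₁ z₂ h₁ h₂ (y k) (Set.mem_insert_of_mem _ ⟨k, rfl⟩)
    rw [pairing_eq_dualPairing] at h3
    have h4 : (⨅ y' ∈ insert y₀ (Set.range y), ((C y' R (s (z₁ - z₂)) : ℝ) : EReal)) ≤
        ((C y₀ R (s (z₁ - z₂)) : ℝ) : EReal) := iInf₂_le y₀ hmem
    have h5 := (EReal.neg_le_neg_iff.2 h4).trans h3
    rw [← EReal.coe_neg, EReal.coe_le_coe_iff] at h5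
    exact h5

/-- The a priori bound for solutions, from coercivity and the positivity of `B`. -/
theorem norm_le_of_coercive {B : LpOn Ω q →L[ℝ] LpOn Ω p}
    (hB : ∀ v : LpOn Ω q, v ≠ 0 → 0 < pairing v (B v))
    {g z : LpOn Ω p} {w b : LpOn Ω q} (hb : B b = g) (hz : z + B w = g) {lam : ℝ}
    (hlam : 0 < lam) (hcoer : lam < ‖z‖ → 0 ≤ pairing (w - b) z) : ‖z‖ ≤ lam := by
  by_contra! hlt
  have hzv : z = -B (w - b) := by
    rw [map_sub, hb, ← hz]; abel
  have hv : w - b ≠ 0 := by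
    intro h0
    rw [hzv, h0, map_zero, neg_zero, norm_zero] at hlt
    exact hlt.not_gt hlam
  have h1 := hcoer hlt
  have h2 := hB _ hv
  rw [pairing_eq_dualPairing] at h1 h2
  rw [hzv, map_neg] at h1
  linarith

/-- Quasi-boundedness: the values of `G` along bounded solutions are bounded as functionals. -/
theorem exists_norm_dualPairing_le [NormedSpace ℝ Y] {G : Y → LpOn Ω p → LpOn Ω q} (hG : HasUSBV G)
    (hcomp : IsCompactInFirstArg G) {y : ℕ → Y} {y₀ : Y} (hy : Tendsto y atTop (𝓝 y₀))
    {z : ℕ → LpOn Ω p} {R₀ c₀ : ℝ} (hz : ∀ k, ‖z k‖ ≤ R₀)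
    (hc : ∀ k, dualPairing Ω q p (G (y k) (z k)) (z k) ≤ c₀) :
    ∃ K : ℝ, ∀ k, ‖dualPairing Ω q p (G (y k) (z k))‖ ≤ K := by
  obtain ⟨c, s, hs, hc1, -, hlow⟩ := hG.exists_lower_bound hy
  obtain ⟨M, hM, hsM⟩ := hs.exists_bound
  set P := dualPairing Ω q p
  have hR₀ : 0 ≤ R₀ := (norm_nonneg _).trans (hz 0)
  have hupper : ∀ h : LpOn Ω p, ∃ K : ℝ, ∀ k, P (G (y k) (z k)) h ≤ K := by
    intro h
    set R := R₀ + ‖h‖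
    have hR : 0 ≤ R := by positivity
    obtain ⟨A, hA⟩ := (isCompact_Icc (a := (0 : ℝ)) (b := M * R)).exists_bound_of_continuousOn
      ((hc1 R hR).mono Set.Icc_subset_Ici_self)
    have hconv := hcomp h y y₀ (WeaklyConverges.of_tendsto hy)
    obtain ⟨D, hD⟩ := (Metric.isBounded_range_of_tendsto _ hconv).exists_norm_le
    refine ⟨c₀ + ‖P‖ * D * R + A, fun k => ?_⟩
    have hzh : ‖z k - h‖ ≤ R := (norm_sub_le _ _).trans (add_le_add (hz k) le_rfl)
    have h1 := hlow R (z k) h ((hz k).trans (by simp [R])) (by simp [R, hR₀]) k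
    have h2 : c R (s (z k - h)) ≤ A := by
      refine (le_abs_self _).trans (hA _ ⟨apply_nonneg s _, (hsM _).trans ?_⟩)
      gcongr
    have h3 : -(P (G (y k) h) (z k - h)) ≤ ‖P‖ * D * R := by
      refine (neg_le_abs _).trans ((P.le_opNorm₂ _ _).trans ?_)
      have hGD : ‖G (y k) h‖ ≤ D := hD _ ⟨k, rfl⟩
      have hD0 : 0 ≤ D := (norm_nonneg _).trans hGD
      gcongr
    have h4 := hc k
    have h5 : P (G (y k) (z k) - G (y k) h) (z k - h) =
        P (G (y k) (z k)) (z k) - P (G (y k) (z k)) h - P (G (y k) h) (z k - h) := by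
      simp only [map_sub, sub_apply]
      ring
    rw [h5] at h1
    linarith
  refine banach_steinhaus fun h => ?_
  obtain ⟨K₁, hK₁⟩ := hupper h
  obtain ⟨K₂, hK₂⟩ := hupper (-h)
  refine ⟨max K₁ K₂, fun k => abs_le.2 ⟨?_, (hK₁ k).trans (le_max_left _ _)⟩⟩
  have := (hK₂ k).trans (le_max_right K₁ K₂)
  rw [map_neg] at this
  linarith

end Operators

section Limit

variable {N : ℕ} {Ω : Set (RN N)} {p q : ℝ≥0∞} [Fact (1 ≤ p)] [Fact (1 ≤ q)]
  [ENNReal.HolderConjugate q p] {Y : Type*} [NormedAddCommGroup Y] [NormedSpace ℝ Y]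
  {B : LpOn Ω q →L[ℝ] LpOn Ω p}

/-- A bounded sequence that is weakly convergent may be paired with a convergent one. -/
theorem tendsto_dualPairing_of_weaklyConverges {v : ℕ → LpOn Ω q} {v₀ : LpOn Ω q}
    {z : ℕ → LpOn Ω p} {z₀ : LpOn Ω p} {R : ℝ} (hR : ∀ k, ‖z k‖ ≤ R)
    (hv : Tendsto v atTop (𝓝 v₀)) (hz : WeaklyConverges z z₀) :
    Tendsto (fun k => dualPairing Ω q p (v k) (z k)) atTop (𝓝 (dualPairing Ω q p v₀ z₀)) := by
  set P := dualPairing Ω q p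
  have h1 : Tendsto (fun k => P (v k - v₀) (z k)) atTop (𝓝 0) := by
    refine squeeze_zero_norm (a := fun k => ‖P‖ * ‖v k - v₀‖ * R)
      (fun k => (P.le_opNorm₂ _ _).trans (by gcongr; exact hR k)) ?_
    have := ((tendsto_iff_norm_sub_tendsto_zero.1 hv).const_mul ‖P‖).mul_const R
    simpa using this
  have h2 := h1.add (hz (P v₀))
  simpa using h2

/-- The positivity of `B` bounds `⟨w_k, z_k⟩`, `z_k = g - B w_k`, from above by a sequence that
converges to `⟨w₀, z₀⟩`, `z₀ = g - B w₀`. -/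
theorem exists_upper_bound_of_positive (hB : ∀ v : LpOn Ω q, v ≠ 0 → 0 < pairing v (B v))
    {g : LpOn Ω p} {w : ℕ → LpOn Ω q} {w₀ : LpOn Ω q} {z : ℕ → LpOn Ω p} {z₀ : LpOn Ω p}
    (hz : ∀ k, z k + B (w k) = g) (hz₀ : z₀ + B w₀ = g)
    (hw : ∀ h, Tendsto (fun k => dualPairing Ω q p (w k) h) atTop (𝓝 (dualPairing Ω q p w₀ h)))
    (hzw : WeaklyConverges z z₀) :
    ∃ a : ℕ → ℝ, (∀ k, dualPairing Ω q p (w k) (z k) ≤ a k) ∧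
      Tendsto a atTop (𝓝 (dualPairing Ω q p w₀ z₀)) := by
  set P := dualPairing Ω q p
  have hpos : ∀ v, 0 ≤ P v (B v) := by
    intro v
    rcases eq_or_ne v 0 with rfl | hv
    · simp
    · rw [← pairing_eq_dualPairing]
      exact (hB v hv).le
  have hzk : ∀ k, B (w k) = g - z k := fun k => eq_sub_of_add_eq' (hz k)
  have hzk₀ : B w₀ = g - z₀ := eq_sub_of_add_eq' hz₀
  refine ⟨fun k => P (w k) z₀ + (P w₀ (z k) - P w₀ z₀), fun k => ?_, ?_⟩
  · have h := hpos (w k - w₀)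
    rw [map_sub B, hzk, hzk₀] at h
    simp only [map_sub, sub_apply] at h
    linarith
  · simpa using (hw z₀).add ((hzw (P w₀)).sub_const (P w₀ z₀))

/-- Minty's argument: the weak limit `w₀` of `G(y_k, z_k)` satisfies a variational inequality. -/
theorem minty_inequality {G : Y → LpOn Ω p → LpOn Ω q} (hcomp : IsCompactInFirstArg G)
    {y : ℕ → Y} {y₀ : Y} (hy : Tendsto y atTop (𝓝 y₀)) {z : ℕ → LpOn Ω p} {z₀ : LpOn Ω p}
    {R : ℝ} (hzR : ∀ k, ‖z k‖ ≤ R) (hzw : WeaklyConverges z z₀) {w₀ : LpOn Ω q}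
    (hw : ∀ h, Tendsto (fun k => dualPairing Ω q p (G (y k) (z k)) h) atTop
      (𝓝 (dualPairing Ω q p w₀ h)))
    {a : ℕ → ℝ} (ha : ∀ k, dualPairing Ω q p (G (y k) (z k)) (z k) ≤ a k)
    (ha₀ : Tendsto a atTop (𝓝 (dualPairing Ω q p w₀ z₀)))
    {c : ℝ → ℝ} {s : Seminorm ℝ (LpOn Ω p)} (hs : IsCompactSeminorm s)
    (hc : ContinuousOn c (Set.Ici 0)) (hlow : ∀ z₁ z₂ : LpOn Ω p, ‖z₁‖ ≤ R → ‖z₂‖ ≤ R → ∀ k,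
      -c (s (z₁ - z₂)) ≤ dualPairing Ω q p (G (y k) z₁ - G (y k) z₂) (z₁ - z₂))
    {h : LpOn Ω p} (hh : ‖h‖ ≤ R) :
    -c (s (z₀ - h)) ≤ dualPairing Ω q p (w₀ - G y₀ h) (z₀ - h) := by
  set P := dualPairing Ω q p
  obtain ⟨θ, hθ, hsz⟩ := hs.exists_subseq_tendsto ⟨R, hzR⟩ hzw
  have hθ' := hθ.tendsto_atTop
  have hslim : Tendsto (fun k => s (z (θ k) - h)) atTop (𝓝 (s (z₀ - h))) := by
    refine tendsto_iff_dist_tendsto_zero.2 (squeeze_zero (fun _ => dist_nonneg) (fun k => ?_) hsz)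
    refine (abs_sub_map_le_sub s _ _).trans (le_of_eq ?_)
    rw [sub_sub_sub_cancel_right]
  have hclim : Tendsto (fun k => -c (s (z (θ k) - h))) atTop (𝓝 (-c (s (z₀ - h)))) := by
    refine Tendsto.neg (Tendsto.comp (hc (s (z₀ - h)) (apply_nonneg s _)) ?_)
    exact tendsto_nhdsWithin_iff.2 ⟨hslim, Eventually.of_forall fun k => apply_nonneg s _⟩
  have hG := hcomp h y y₀ (WeaklyConverges.of_tendsto hy)
  have hGz := tendsto_dualPairing_of_weaklyConverges hzR hG hzw
  have hGh : Tendsto (fun k => P (G (y k) h) h) atTop (𝓝 (P (G y₀ h) h)) :=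
    ((P.flip h).continuous.tendsto _).comp hG
  have hlim : Tendsto (fun k => a k - P (G (y k) (z k)) h - P (G (y k) h) (z k) + P (G (y k) h) h)
      atTop (𝓝 (P w₀ z₀ - P w₀ h - P (G y₀ h) z₀ + P (G y₀ h) h)) :=
    ((ha₀.sub (hw h)).sub hGz).add hGh
  have hfin := le_of_tendsto_of_tendsto' hclim (hlim.comp hθ') fun k => by
    have h1 := hlow (z (θ k)) h (hzR _) hh (θ k)
    have h2 := ha (θ k)
    simp only [map_sub, sub_apply] at h1
    simp only [Function.comp_apply]
    linarith
  simp only [map_sub, sub_apply]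
  linarith

/-- The variational inequality and radial continuity identify the weak limit of `G(y_k, z_k)`. -/
theorem dualPairing_eq_of_minty {G : LpOn Ω p → LpOn Ω q} (hrad : RadiallyContinuous G)
    {s : Seminorm ℝ (LpOn Ω p)} {c : ℝ → ℝ → ℝ} {R₀ : ℝ}
    (hc : ∀ R : ℝ, 0 ≤ R → ContinuousOn (c R) (Set.Ici 0))
    (hc₀ : ∀ R : ℝ, 0 < R → Tendsto (fun t : ℝ => (1 / t) * c R t) (𝓝[>] 0) (𝓝 0))
    {w₀ : LpOn Ω q} {z₀ : LpOn Ω p}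
    (hminty : ∀ (R : ℝ) (h : LpOn Ω p), R₀ ≤ R → ‖h‖ ≤ R →
      -c R (s (z₀ - h)) ≤ dualPairing Ω q p (w₀ - G h) (z₀ - h)) :
    dualPairing Ω q p w₀ = dualPairing Ω q p (G z₀) := by
  set P := dualPairing Ω q p
  have hle : ∀ v, P w₀ v ≤ P (G z₀) v := by
    intro v
    obtain ⟨ε, hε, hcont⟩ := hrad z₀ v
    set R := max R₀ (‖z₀‖ + ε * ‖v‖) + 1 with hRdef
    have hR : 0 < R := by
      have : 0 ≤ ‖z₀‖ + ε * ‖v‖ := by positivity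
      linarith [le_max_right R₀ (‖z₀‖ + ε * ‖v‖)]
    have hradlim : Tendsto (fun t : ℝ => P (G (z₀ + t • v)) v) (𝓝[>] 0) (𝓝 (P (G z₀) v)) := by
      have h1 := (hcont 0 ⟨le_rfl, hε.le⟩).tendsto
      simp only [zero_smul, add_zero, pairing_eq_dualPairing] at h1
      rw [← nhdsWithin_Ioc_eq_nhdsGT hε]
      exact h1.mono_left (nhdsWithin_mono _ Set.Ioc_subset_Icc_self)
    have hclim : Tendsto (fun t : ℝ => (1 / t) * c R (t * s v)) (𝓝[>] 0) (𝓝 0) := by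
      rcases (apply_nonneg s v).eq_or_lt with hs0 | hs0
      · have hcz : c R 0 = 0 := by
          have h1 : Tendsto (c R) (𝓝[>] 0) (𝓝 (c R 0)) :=
            ((hc R hR.le) 0 Set.self_mem_Ici).tendsto.mono_left
              (nhdsWithin_mono _ Set.Ioi_subset_Ici_self)
          have h2 : Tendsto (fun t : ℝ => t * ((1 / t) * c R t)) (𝓝[>] 0) (𝓝 (0 * 0)) :=
            (tendsto_id.mono_left nhdsWithin_le_nhds).mul (hc₀ R hR)
          rw [mul_zero] at h2
          refine tendsto_nhds_unique h1 (h2.congr' ?_)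
          filter_upwards [self_mem_nhdsWithin] with t ht
          have : t ≠ 0 := (Set.mem_Ioi.1 ht).ne'
          field_simp
        simp [← hs0, hcz]
      · have h1 : Tendsto (fun t : ℝ => t * s v) (𝓝[>] 0) (𝓝[>] 0) := by
          refine tendsto_nhdsWithin_iff.2 ⟨?_, ?_⟩
          · have : Tendsto (fun t : ℝ => t * s v) (𝓝 0) (𝓝 (0 * s v)) :=
              tendsto_id.mul_const _
            rw [zero_mul] at this
            exact this.mono_left nhdsWithin_le_nhds
          · filter_upwards [self_mem_nhdsWithin] with t ht
            exact mul_pos ht hs0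
        have h2 := ((hc₀ R hR).comp h1).const_mul (s v)
        rw [mul_zero] at h2
        refine h2.congr fun t => ?_
        simp only [Function.comp_apply]
        field_simp
    have hlim := hradlim.add hclim
    rw [add_zero] at hlim
    refine ge_of_tendsto hlim ?_
    filter_upwards [Ioc_mem_nhdsGT hε] with t ht
    have hnorm : ‖z₀ + t • v‖ ≤ R := by
      refine (norm_add_le _ _).trans ?_
      rw [norm_smul, Real.norm_eq_abs, abs_of_pos ht.1]
      have : t * ‖v‖ ≤ ε * ‖v‖ := mul_le_mul_of_nonneg_right ht.2 (norm_nonneg v)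
      linarith [le_max_right R₀ (‖z₀‖ + ε * ‖v‖)]
    have h1 := hminty R (z₀ + t • v) (by linarith [le_max_left R₀ (‖z₀‖ + ε * ‖v‖)]) hnorm
    rw [sub_add_cancel_left, map_neg_eq_map, map_smul_eq_mul, Real.norm_eq_abs, abs_of_pos ht.1]
      at h1
    simp only [map_neg, map_smul, map_sub, sub_apply, smul_eq_mul] at h1
    have h2 : t * P w₀ v ≤ t * (P (G (z₀ + t • v)) v + 1 / t * c R (t * s v)) := by
      have : t * (1 / t * c R (t * s v)) = c R (t * s v) := by
        have := ht.1.ne'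
        field_simp
      rw [mul_add, this]
      linarith
    exact le_of_mul_le_mul_left h2 ht.1
  ext v
  refine le_antisymm (hle v) ?_
  have := hle (-v)
  simp only [map_neg] at this
  linarith

/-- Solutions for a convergent sequence `y_k` have a subsequence that converges to a solution for
the limit of `y_k`. -/
theorem exists_subseq_tendsto_solution [ENNReal.HolderConjugate p q]
    [IsFiniteMeasure ((volume : Measure (RN N)).restrict Ω)] (hp : p ≠ ⊤) (hq : q ≠ ⊤)
    (hB : ∀ v : LpOn Ω q, v ≠ 0 → 0 < pairing v (B v))
    {F : Y → LpOn Ω p → LpOn Ω q} {g : LpOn Ω p} {b : LpOn Ω q} (hb : B b = g)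
    (hFusbv : HasUSBV F) (hFrad : ∀ y : Y, RadiallyContinuous (F y))
    (hFcoer : ∀ Y₀ : Set Y, Bornology.IsBounded Y₀ →
      ∃ lam : ℝ, 0 < lam ∧ ∀ y ∈ Y₀, ∀ z : LpOn Ω p, lam < ‖z‖ → 0 ≤ pairing (F y z - b) z)
    (hFcomp : IsCompactInFirstArg F) (hFM : HasMProperty F) (hFA : HasAProperty F)
    {y : ℕ → Y} {y₀ : Y} (hy : Tendsto y atTop (𝓝 y₀))
    {z : ℕ → LpOn Ω p} (hz : ∀ k, z k + B (F (y k) (z k)) = g) :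
    ∃ (z₀ : LpOn Ω p) (θ : ℕ → ℕ), z₀ + B (F y₀ z₀) = g ∧ StrictMono θ ∧
      Tendsto (z ∘ θ) atTop (𝓝 z₀) := by
  set P := dualPairing Ω q p with hP
  obtain ⟨R₀, hR₀, hcoer⟩ := hFcoer _ (Metric.isBounded_range_of_tendsto y hy)
  have hzR : ∀ k, ‖z k‖ ≤ R₀ := fun k =>
    norm_le_of_coercive hB hb (hz k) hR₀ (hcoer (y k) ⟨k, rfl⟩ (z k))
  have hupper : ∀ k, P (F (y k) (z k)) (z k) ≤ ‖P b‖ * R₀ := by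
    intro k
    have h1 : z k = -B (F (y k) (z k) - b) := by
      rw [map_sub, hb, ← hz k]; abel
    have h2 : P (F (y k) (z k) - b) (z k) ≤ 0 := by
      have h3 : P (F (y k) (z k) - b) (z k) = -P (F (y k) (z k) - b) (B (F (y k) (z k) - b)) := by
        rw [← map_neg, ← h1]
      rw [h3, neg_nonpos, ← pairing_eq_dualPairing]
      rcases eq_or_ne (F (y k) (z k) - b) 0 with h0 | h0
      · rw [h0, map_zero, pairing_eq_dualPairing, map_zero]
      · exact (hB _ h0).le
    rw [map_sub, sub_apply, sub_nonpos] at h2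
    exact h2.trans ((le_abs_self _).trans ((P b).le_opNorm_of_le (hzR k)))
  obtain ⟨K, hK⟩ := exists_norm_dualPairing_le hFusbv hFcomp hy hzR hupper
  obtain ⟨w₀, θ, hθ, hw⟩ := exists_subseq_tendsto_lpPairing hp hq hK
  set z₀ := g - B w₀ with hz₀
  have hyθ : Tendsto (y ∘ θ) atTop (𝓝 y₀) := hy.comp hθ.tendsto_atTop
  have hzw : WeaklyConverges (z ∘ θ) z₀ := by
    intro ℓ
    obtain ⟨f, hf⟩ := exists_lpPairing_eq (p := q) (q := p) hq hp (ℓ.comp B)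
    have hℓ : ∀ v : LpOn Ω q, ℓ (B v) = P v f := by
      intro v
      rw [← ContinuousLinearMap.comp_apply, ← hf, ContinuousLinearMap.lpPairing_eq_integral, hP,
        ← pairing_eq_dualPairing]
      exact integral_congr_ae (Eventually.of_forall fun x => mul_comm _ _)
    have h1 : ∀ k, ℓ ((z ∘ θ) k) = ℓ g - P (F (y (θ k)) (z (θ k))) f := fun k => by
      rw [← hℓ, ← map_sub, ← eq_sub_of_add_eq (hz (θ k))]; rfl
    simp only [h1, hz₀, map_sub, hℓ]
    exact (hw f).const_sub _
  obtain ⟨a, ha, ha₀⟩ := exists_upper_bound_of_positive hB (fun k => hz (θ k))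
    (sub_add_cancel g (B w₀)) hw hzw
  obtain ⟨c, s, hs, hc, hc₀, hlow⟩ := hFusbv.exists_lower_bound hyθ
  have hPw : P w₀ = P (F y₀ z₀) := by
    refine dualPairing_eq_of_minty (s := s) (R₀ := R₀) (hFrad y₀) hc hc₀ fun R h hR hh => ?_
    exact minty_inequality hFcomp hyθ (fun k => (hzR (θ k)).trans hR) hzw hw ha
      ha₀ hs (hc R (hR₀.le.trans hR)) (hlow R) hh
  have hwF : w₀ = F y₀ z₀ := by
    by_contra hne
    have h1 := hB _ (sub_ne_zero.2 hne)
    rw [pairing_eq_dualPairing, map_sub, hPw, sub_self] at h1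
    exact lt_irrefl _ h1
  refine ⟨z₀, θ, by rw [← hwF, hz₀, sub_add_cancel], hθ, hFM _ _ _ _ hyθ hzw ?_⟩
  rw [← EReal.tendsto_coe]
  refine tendsto_of_le_liminf_of_limsup_le (hFA _ _ _ _ hyθ hzw) ?_
  have h1 : Tendsto (fun k => ((a k : ℝ) : EReal)) atTop
      (𝓝 ((pairing (F y₀ z₀) z₀ : ℝ) : EReal)) := by
    rw [EReal.tendsto_coe, pairing_eq_dualPairing, ← hP, ← hPw]
    exact ha₀
  rw [← h1.limsup_eq]
  refine limsup_le_limsup (Eventually.of_forall fun k => ?_)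
  rw [EReal.coe_le_coe_iff, pairing_eq_dualPairing]
  exact ha k

end Limit

end Hammerstein

open Hammerstein in
theorem mainTheorem3 (N : ℕ) (hN : 1 ≤ N) (Ω : Set (RN N)) (hΩo : IsOpen Ω)
    (hΩb : Bornology.IsBounded Ω)
    (p q : ℝ≥0∞) [Fact (1 ≤ p)] [Fact (1 ≤ q)] (hp2 : 2 ≤ p) (hp : p ≠ ⊤)
    (hpq : 1 / p + 1 / q = 1)
    -- the operators `B` (linear, continuous, positive) and `F`
    (B : LpOn Ω q →L[ℝ] LpOn Ω p) (hB : ∀ v : LpOn Ω q, v ≠ 0 → 0 < pairing v (B v))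
    (F : W01p Ω p → LpOn Ω p → LpOn Ω q)
    -- a right inverse of `B`, defined on a set `D` that contains `g`
    (D : Set (LpOn Ω p)) (Binv : D → LpOn Ω q) (hBinv : ∀ z : D, B (Binv z) = z) (g : D)
    (hFusbv : HasUSBV F) (hFrad : ∀ y : W01p Ω p, RadiallyContinuous (F y))
    (hFcoer : ∀ Y₀ : Set (W01p Ω p), Bornology.IsBounded Y₀ →
      ∃ lam : ℝ, 0 < lam ∧ ∀ y ∈ Y₀, ∀ z : LpOn Ω p, lam < ‖z‖ →
        0 ≤ pairing (F y z - Binv g) z)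
    (hFcomp : IsCompactInFirstArg F) (hFM : HasMProperty F) (hFA : HasAProperty F)
    (y : ℕ → W01p Ω p) (y₀ : W01p Ω p) (hy : Tendsto y atTop (𝓝 y₀))
    (z : ℕ → LpOn Ω p) (hz : ∀ k, z k ∈ solutionSet B F g (y k)) :
    IsCompact (closure (Set.range z)) ∧
      ∃ z₀ ∈ solutionSet B F g y₀, ∃ θ : ℕ → ℕ, StrictMono θ ∧
        Tendsto (fun k => z (θ k)) atTop (𝓝 z₀) := by
  have hfin : IsFiniteMeasure ((volume : Measure (RN N)).restrict Ω) :=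
    isFiniteMeasure_restrict.2 hΩb.measure_lt_top.ne
  have hpq' : ENNReal.HolderConjugate p q := ⟨by simpa using hpq⟩
  have hqp' : ENNReal.HolderConjugate q p := ⟨by simpa [add_comm] using hpq⟩
  have hq : q ≠ ⊤ := by
    rintro rfl
    simp only [one_div, ENNReal.inv_top, add_zero, ENNReal.inv_eq_one] at hpq
    rw [hpq] at hp2
    exact absurd hp2 (by norm_num)
  simp only [mem_solutionSet_iff hΩo] at hz ⊢
  have key : ∀ θ : ℕ → ℕ, StrictMono θ → ∃ (z₀ : LpOn Ω p) (η : ℕ → ℕ),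
      z₀ + B (F y₀ z₀) = g ∧ StrictMono η ∧ Tendsto (z ∘ θ ∘ η) atTop (𝓝 z₀) :=
    fun θ hθ => exists_subseq_tendsto_solution hp hq hB (hBinv g) hFusbv hFrad hFcoer hFcomp hFM hFA
      (hy.comp hθ.tendsto_atTop) fun k => hz (θ k)
  refine ⟨isCompact_closure_range_of_forall_subseq fun θ hθ => ?_, ?_⟩
  · obtain ⟨z₀, η, -, h⟩ := key θ hθ
    exact ⟨z₀, η, h⟩
  · obtain ⟨z₀, η, h⟩ := key id strictMono_id
    exact ⟨z₀, h.1, η, h.2⟩
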